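/- Let $D_\infty=\mathbb{Z}\rtimes\mathbb{Z}_2$ be the infinite dihedral group, with the discrete topology, let $X$ be a Cantor space (a space homeomorphic to $\{0,1\}^{\mathbb{N}}$), and let $\phi\colon D_\infty\curvearrowright X$ be an action by homeomorphisms that is free ($g\cdot x=x$ for some $x \in X$ implies $g=1$) and minimal (every orbit is dense). Then $$\mathrm{dad}\bigl((X\rtimes_\phi D_\infty)\times\mathcal{R}_{2^\infty}\bigr)=1 .$$ Here: * $X\rtimes_\phi D_\infty$ is the transformation groupoid $D_\infty\times X$ with the product topology, unit space $X$, $s(g,x)=x$, $r(g,x)=g\cdot x$, $(g,h\cdot x)(h,x)=(gh,x)$ and $(g,x)^{-1}=(g^{-1},g\cdot x)$. * $\mathcal{R}_{2^\infty}$, the canonical groupoid of the UHF algebra $M_{2^\infty}$, is the tail equivalence relation $\bigcup_{n}R_n$ on $\{0,1\}^{\mathbb{N}}$, where $R_n=\{(x,y): x_i=y_i \text{ for all } i\ge n\}$ has the subspace topology of $\{0,1\}^{\mathbb{N}}\times\{0,1\}^{\mathbb{N}}$ and the union has the inductive limit topology; $r(x,y)=x$, $s(x,y)=y$. * The product of two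 groupoids has componentwise operations and the product topology. * For a locally compact, Hausdorff, étale groupoid $\mathcal{G}$ with unit space $\mathcal{G}^{(0)}$, $\mathrm{dad}(\mathcal{G})$ (the dynamic asymptotic dimension) is the smallest $d\in\mathbb{N}=\{0,1,2,\dots\}$ such that for every open relatively compact $K\subseteq\mathcal{G}$ there are open sets $U_0,\dots,U_d\subseteq\mathcal{G}^{(0)}$ covering $s(K)\cup r(K)$ such that, for each $i\in\{0,\dots,d\}$, the set $\{g\in K: s(g),r(g)\in U_i\}$ is contained in a relatively compact subgroupoid of $\mathcal{G}$; if no such $d$ exists, $\mathrm{dad}(\mathcal{G})=\infty$. -/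

import Mathlib

universe u v u' v'

set_option linter.checkUnivs false

/-- A locally compact, Hausdorff, étale topological groupoid, with unit space `Obj` and space of
arrows `Arr`.  The unit space is identified with a subspace of `Arr` through `unit`; the product
`g h` is defined exactly when `s g = r h`. -/
structure EtaleGroupoid : Type (max u v + 1) where
  /-- the unit space -/
  Obj : Type u
  /-- the space of arrows -/
  Arr : Type v
  [topObj : TopologicalSpace Obj]
  [topArr : TopologicalSpace Arr]
  /-- the range map -/
  r : Arr → Obj
  /-- the source map -/
  s : Arr → Obj
  /-- the inclusion of the units -/
  unit : Obj → Arr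
  /-- the partial multiplication -/
  mul : ∀ g h : Arr, s g = r h → Arr
  /-- the inversion -/
  inv : Arr → Arr
  r_unit : ∀ x, r (unit x) = x
  s_unit : ∀ x, s (unit x) = x
  r_mul : ∀ g h (e : s g = r h), r (mul g h e) = r g
  s_mul : ∀ g h (e : s g = r h), s (mul g h e) = s h
  r_inv : ∀ g, r (inv g) = s g
  s_inv : ∀ g, s (inv g) = r g
  unit_mul : ∀ g, mul (unit (r g)) g (s_unit (r g)) = g
  mul_unit : ∀ g, mul g (unit (s g)) (r_unit (s g)).symm = g
  mul_assoc : ∀ g h k (e : s g = r h) (e' : s h = r k),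
    mul (mul g h e) k ((s_mul g h e).trans e') = mul g (mul h k e') (e.trans (r_mul h k e').symm)
  mul_inv : ∀ g, mul g (inv g) (r_inv g).symm = unit (r g)
  inv_mul : ∀ g, mul (inv g) g (s_inv g) = unit (s g)
  continuous_unit : Continuous unit
  continuous_mul : Continuous fun p : {p : Arr × Arr // s p.1 = r p.2} => mul p.1.1 p.1.2 p.2
  continuous_inv : Continuous inv
  isLocalHomeomorph_r : IsLocalHomeomorph r
  isLocalHomeomorph_s : IsLocalHomeomorph s
  t2Space_arr : T2Space Arr
  locallyCompactSpace_arr : LocallyCompactSpace Arr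

theorem isLocalHomeomorph_prodMap {A B C D : Type*} [TopologicalSpace A] [TopologicalSpace B]
    [TopologicalSpace C] [TopologicalSpace D] {f : A → B} {g : C → D}
    (hf : IsLocalHomeomorph f) (hg : IsLocalHomeomorph g) :
    IsLocalHomeomorph fun p : A × C => (f p.1, g p.2) := by
  rintro ⟨a, c⟩
  obtain ⟨e, he, rfl⟩ := hf a
  obtain ⟨e', he', rfl⟩ := hg c
  exact ⟨e.prod e', ⟨he, he'⟩, rfl⟩

namespace EtaleGroupoid

attribute [instance] topObj topArr

/-- A set of arrows is (the set of arrows of) a subgroupoid if it is closed under products and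
inverses; it then contains the units at the ranges and sources of its elements. -/
def IsSubgroupoid (G : EtaleGroupoid.{u, v}) (H : Set G.Arr) : Prop :=
  (∀ g ∈ H, G.inv g ∈ H) ∧
    ∀ g ∈ H, ∀ h ∈ H, ∀ e : G.s g = G.r h, G.mul g h e ∈ H

/-- The covering property that occurs in the definition of dynamic asymptotic dimension. -/
def HasDadProperty (G : EtaleGroupoid.{u, v}) (d : ℕ) : Prop :=
  ∀ K : Set G.Arr, IsOpen K → IsCompact (closure K) →
    ∃ U : Fin (d + 1) → Set G.Obj,
      (∀ i, IsOpen (U i)) ∧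
      G.s '' K ∪ G.r '' K ⊆ ⋃ i, U i ∧
      ∀ i, ∃ H : Set G.Arr, G.IsSubgroupoid H ∧ IsCompact (closure H) ∧
        {g | g ∈ K ∧ G.s g ∈ U i ∧ G.r g ∈ U i} ⊆ H

/-- The dynamic asymptotic dimension: the smallest natural number `d` with the covering property,
and `⊤` if there is none. -/
noncomputable def dad (G : EtaleGroupoid.{u, v}) : ℕ∞ :=
  ⨅ (d : ℕ) (_ : G.HasDadProperty d), (d : ℕ∞)

/-- The product of two groupoids, with componentwise operations and the product topologies. -/
def prod (G : EtaleGroupoid.{u, v}) (H : EtaleGroupoid.{u', v'}) :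
    EtaleGroupoid.{max u u', max v v'} where
  Obj := G.Obj × H.Obj
  Arr := G.Arr × H.Arr
  r g := (G.r g.1, H.r g.2)
  s g := (G.s g.1, H.s g.2)
  unit x := (G.unit x.1, H.unit x.2)
  mul g h e := (G.mul g.1 h.1 (congrArg Prod.fst e), H.mul g.2 h.2 (congrArg Prod.snd e))
  inv g := (G.inv g.1, H.inv g.2)
  r_unit x := by simp [G.r_unit, H.r_unit]
  s_unit x := by simp [G.s_unit, H.s_unit]
  r_mul g h e := by simp [G.r_mul, H.r_mul]
  s_mul g h e := by simp [G.s_mul, H.s_mul]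
  r_inv g := by simp [G.r_inv, H.r_inv]
  s_inv g := by simp [G.s_inv, H.s_inv]
  unit_mul g := by simp [G.unit_mul, H.unit_mul]
  mul_unit g := by simp [G.mul_unit, H.mul_unit]
  mul_assoc g h k e e' := Prod.ext
    (G.mul_assoc g.1 h.1 k.1 (congrArg Prod.fst e) (congrArg Prod.fst e'))
    (H.mul_assoc g.2 h.2 k.2 (congrArg Prod.snd e) (congrArg Prod.snd e'))
  mul_inv g := by simp [G.mul_inv, H.mul_inv]
  inv_mul g := by simp [G.inv_mul, H.inv_mul]
  continuous_unit := G.continuous_unit.prodMap H.continuous_unit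
  continuous_mul := by
    refine Continuous.prodMk ?_ ?_
    · exact G.continuous_mul.comp (Continuous.subtype_mk (f := fun p :
        {p : (G.Arr × H.Arr) × (G.Arr × H.Arr) //
          (G.s p.1.1, H.s p.1.2) = (G.r p.2.1, H.r p.2.2)} => (p.1.1.1, p.1.2.1))
        (by fun_prop) (fun p => congrArg Prod.fst p.2))
    · exact H.continuous_mul.comp (Continuous.subtype_mk (f := fun p :
        {p : (G.Arr × H.Arr) × (G.Arr × H.Arr) //
          (G.s p.1.1, H.s p.1.2) = (G.r p.2.1, H.r p.2.2)} => (p.1.1.2, p.1.2.2))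
        (by fun_prop) (fun p => congrArg Prod.snd p.2))
  continuous_inv := G.continuous_inv.prodMap H.continuous_inv
  isLocalHomeomorph_r := isLocalHomeomorph_prodMap G.isLocalHomeomorph_r H.isLocalHomeomorph_r
  isLocalHomeomorph_s := isLocalHomeomorph_prodMap G.isLocalHomeomorph_s H.isLocalHomeomorph_s
  t2Space_arr := by
    have := G.t2Space_arr
    have := H.t2Space_arr
    infer_instance
  locallyCompactSpace_arr := by
    have := G.locallyCompactSpace_arr
    have := H.locallyCompactSpace_arr
    infer_instance

end EtaleGroupoid

theorem isLocalHomeomorph_snd_of_discrete (G : Type*) (X : Type*) [TopologicalSpace G]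
    [DiscreteTopology G] [TopologicalSpace X] : IsLocalHomeomorph (Prod.snd : G × X → X) := by
  rw [isLocalHomeomorph_iff_isOpenEmbedding_restrict]
  rintro ⟨g, x⟩
  have ho : IsOpen {p : G × X | p.1 = g} := (isOpen_discrete {g}).preimage continuous_fst
  refine ⟨{p : G × X | p.1 = g}, ho.mem_nhds rfl, ?_⟩
  refine Topology.IsOpenEmbedding.of_continuous_injective_isOpenMap ?_ ?_ ?_
  · exact continuous_snd.comp continuous_subtype_val
  · rintro ⟨⟨a, y⟩, rfl⟩ ⟨⟨b, z⟩, hb⟩ h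
    obtain rfl : b = a := hb
    obtain rfl : y = z := h
    rfl
  · exact isOpenMap_snd.comp ho.isOpenMap_subtype_val

/-- The transformation groupoid `X ⋊ G` of an action of a discrete group by homeomorphisms of a
locally compact Hausdorff space: `(g, x)` is an arrow from `x` to `g • x`, and
`(g, h • x) (h, x) = (g * h, x)`. -/
def transformationGroupoid (G : Type u) (X : Type v) [Group G] [TopologicalSpace G]
    [DiscreteTopology G] [TopologicalSpace X] [T2Space X] [LocallyCompactSpace X]
    [MulAction G X] [ContinuousConstSMul G X] : EtaleGroupoid.{v, max u v} where
  Obj := X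
  Arr := G × X
  r p := p.1 • p.2
  s p := p.2
  unit x := (1, x)
  mul p q _ := (p.1 * q.1, q.2)
  inv p := (p.1⁻¹, p.1 • p.2)
  r_unit x := one_smul G x
  s_unit _ := rfl
  r_mul p q e := by
    change (p.1 * q.1) • q.2 = p.1 • p.2
    rw [mul_smul, ← e]
  s_mul _ _ _ := rfl
  r_inv p := inv_smul_smul p.1 p.2
  s_inv _ := rfl
  unit_mul p := by simp
  mul_unit p := by simp
  mul_assoc p q k _ _ := by simp [mul_assoc]
  mul_inv p := by simp
  inv_mul p := by simp
  continuous_unit := by fun_prop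
  continuous_mul := by
    have h : Continuous fun q : G × G => q.1 * q.2 := continuous_of_discreteTopology
    refine Continuous.prodMk ?_ (by fun_prop)
    exact h.comp (g := fun q : G × G => q.1 * q.2) (f := fun p : {p : (G × X) × (G × X) //
      p.1.2 = p.2.1 • p.2.2} => (p.1.1.1, p.1.2.1)) (by fun_prop)
  continuous_inv := by
    have h : Continuous fun g : G => g⁻¹ := continuous_of_discreteTopology
    exact (h.comp continuous_fst).prodMk
      (continuous_prod_of_discrete_left.mpr fun g => continuous_const_smul g)
  isLocalHomeomorph_r := by
    have hr : Continuous fun p : G × X => p.1 • p.2 :=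
      continuous_prod_of_discrete_left.mpr fun g => continuous_const_smul g
    have hi : Continuous fun p : G × X => p.1⁻¹ • p.2 :=
      continuous_prod_of_discrete_left.mpr fun g => continuous_const_smul g⁻¹
    let e : G × X ≃ₜ G × X :=
      { toFun := fun p => (p.1, p.1 • p.2)
        invFun := fun p => (p.1, p.1⁻¹ • p.2)
        left_inv := fun p => by simp
        right_inv := fun p => by simp
        continuous_toFun := continuous_fst.prodMk hr
        continuous_invFun := continuous_fst.prodMk hi }
    exact (isLocalHomeomorph_snd_of_discrete G X).comp e.isLocalHomeomorph
  isLocalHomeomorph_s := isLocalHomeomorph_snd_of_discrete G X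
  t2Space_arr := inferInstance
  locallyCompactSpace_arr := inferInstance

/-- The infinite dihedral group `DihedralGroup 0` is regarded as a discrete group. -/
instance DihedralGroup.instTopologicalSpaceZero : TopologicalSpace (DihedralGroup 0) := ⊥

instance DihedralGroup.instDiscreteTopologyZero : DiscreteTopology (DihedralGroup 0) := ⟨rfl⟩

/-- A Cantor space: a space homeomorphic to `{0,1}^ℕ`. -/
class IsCantorSpace (X : Type u) [TopologicalSpace X] : Prop where
  nonempty_homeomorph : Nonempty (X ≃ₜ (ℕ → Bool))

instance IsCantorSpace.compactSpace (X : Type u) [TopologicalSpace X] [IsCantorSpace X] :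
    CompactSpace X :=
  (IsCantorSpace.nonempty_homeomorph (X := X)).elim fun e => e.symm.compactSpace

instance IsCantorSpace.t2Space (X : Type u) [TopologicalSpace X] [IsCantorSpace X] :
    T2Space X :=
  (IsCantorSpace.nonempty_homeomorph (X := X)).elim fun e => e.symm.t2Space

/-! ### The groupoid of the UHF algebra of type `2^∞` -/

/-- The pairs of binary sequences that agree from the index `n` on, with the subspace topology
of `{0,1}^ℕ × {0,1}^ℕ`. -/
abbrev TailPairs (n : ℕ) : Type :=
  {p : (ℕ → Bool) × (ℕ → Bool) // ∀ i, n ≤ i → p.1 i = p.2 i}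

/-- Tail equivalence: the pairs of binary sequences that differ in finitely many places only. -/
@[ext]
structure TailRel : Type where
  /-- the first sequence -/
  fst : ℕ → Bool
  /-- the second sequence -/
  snd : ℕ → Bool
  eventually_eq : ∃ n, ∀ i, n ≤ i → fst i = snd i

/-- The inclusion of `TailPairs n` in their increasing union `TailRel`. -/
def TailPairs.incl (n : ℕ) (p : TailPairs n) : TailRel := ⟨p.1.1, p.1.2, n, p.2⟩

/-- The inductive limit topology on `TailRel = ⋃ n, TailPairs n`, where `TailPairs n` has the
subspace topology of `{0,1}^ℕ × {0,1}^ℕ`: a set is open if and only if its intersection with each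
`TailPairs n` is open there. -/
instance TailRel.instTopologicalSpace : TopologicalSpace TailRel :=
  ⨆ n, TopologicalSpace.coinduced (TailPairs.incl n) inferInstance

namespace TailRel

theorem finite_diff (p : TailRel) : {i | p.fst i ≠ p.snd i}.Finite := by
  obtain ⟨n, hn⟩ := p.eventually_eq
  refine (Set.finite_lt_nat n).subset fun i hi => ?_
  by_contra h
  exact hi (hn i (not_lt.mp h))

/-- Change a binary sequence in the places of a finite set. -/
def flip (F : Finset ℕ) (x : ℕ → Bool) : ℕ → Bool := fun i => if i ∈ F then !(x i) else x i

theorem continuous_flip (F : Finset ℕ) : Continuous (flip F) := by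
  refine continuous_pi fun i => ?_
  unfold flip
  by_cases h : i ∈ F
  · simp only [h, if_true]
    exact (continuous_of_discreteTopology (f := Bool.not)).comp (continuous_apply i)
  · simp only [h, if_false]
    exact continuous_apply i

theorem flip_flip (F : Finset ℕ) (x : ℕ → Bool) : flip F (flip F x) = x := by
  funext i
  by_cases h : i ∈ F <;> simp [flip, h]

/-- The set of places where the two sequences differ. -/
noncomputable def diff (p : TailRel) : Finset ℕ := p.finite_diff.toFinset

theorem mem_diff (p : TailRel) (i : ℕ) : i ∈ diff p ↔ p.fst i ≠ p.snd i := by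
  simp [diff]

local instance : TopologicalSpace (Finset ℕ) := ⊥
local instance : DiscreteTopology (Finset ℕ) := ⟨rfl⟩

theorem continuous_incl (n : ℕ) : Continuous (TailPairs.incl n) :=
  continuous_iSup_rng (i := n) continuous_coinduced_rng

theorem continuous_dom {Y : Type*} [TopologicalSpace Y] {f : TailRel → Y}
    (h : ∀ n, Continuous (f ∘ TailPairs.incl n)) : Continuous f :=
  continuous_iSup_dom.mpr fun n => continuous_coinduced_dom.mpr (h n)

theorem continuous_fst' : Continuous TailRel.fst :=
  continuous_dom fun _ => continuous_fst.comp continuous_subtype_val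

theorem continuous_snd' : Continuous TailRel.snd :=
  continuous_dom fun _ => continuous_snd.comp continuous_subtype_val

theorem continuous_diff : Continuous diff := by
  refine continuous_dom fun n => ?_
  have h1 : Continuous fun p : TailPairs n => fun i : Fin n => decide (p.1.1 i ≠ p.1.2 i) := by
    refine continuous_pi fun i => ?_
    have h2 : Continuous fun b : Bool × Bool => decide (b.1 ≠ b.2) :=
      continuous_of_discreteTopology
    have h3 : Continuous fun p : TailPairs n => (p.1.1 (i : ℕ), p.1.2 (i : ℕ)) :=
      Continuous.prodMk
        ((continuous_apply (i : ℕ)).comp (continuous_fst.comp continuous_subtype_val))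
        ((continuous_apply (i : ℕ)).comp (continuous_snd.comp continuous_subtype_val))
    exact h2.comp h3
  have h4 : Continuous fun f : Fin n → Bool =>
      (Finset.range n).filter fun i => ∃ h : i < n, f ⟨i, h⟩ = true :=
    continuous_of_discreteTopology
  refine (h4.comp h1).congr fun p => ?_
  ext i
  have := p.2 i
  simp only [Function.comp, mem_diff, TailPairs.incl, Finset.mem_filter, Finset.mem_range,
    decide_eq_true_eq]
  constructor
  · rintro ⟨-, -, h⟩
    exact h
  · intro h
    have hi : i < n := by
      by_contra hc
      exact h (p.2 i (not_lt.mp hc))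
    exact ⟨hi, hi, h⟩

/-- `TailRel` is homeomorphic to a disjoint union of copies of `{0,1}^ℕ`, through the source map
and the set of differing places. -/
noncomputable def homeo : TailRel ≃ₜ Finset ℕ × (ℕ → Bool) where
  toFun p := (diff p, p.snd)
  invFun q := ⟨flip q.1 q.2, q.2, q.1.sup id + 1, fun i hi => by
    have : i ∉ q.1 := fun h => by
      have := Finset.le_sup (f := id) h
      simp only [id] at this
      omega
    simp [flip, this]⟩
  left_inv p := by
    refine TailRel.ext (funext fun i => ?_) rfl
    have := mem_diff p i
    simp only [flip, this]
    cases p.fst i <;> cases p.snd i <;> simp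
  right_inv q := by
    refine Prod.ext (Finset.ext fun i => ?_) rfl
    refine (mem_diff _ i).trans ?_
    by_cases h : i ∈ q.1 <;> simp [flip, h]
  continuous_toFun := continuous_diff.prodMk continuous_snd'
  continuous_invFun := by
    refine continuous_prod_of_discrete_left.mpr fun F => ?_
    have h : ∀ x : ℕ → Bool, ∀ i, F.sup id + 1 ≤ i → flip F x i = x i := fun x i hi => by
      have : i ∉ F := fun h => by
        have := Finset.le_sup (f := id) h
        simp only [id] at this
        omega
      simp [flip, this]
    have h2 : Continuous fun x : ℕ → Bool => (⟨(flip F x, x), h x⟩ : TailPairs (F.sup id + 1)) :=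
      Continuous.subtype_mk ((continuous_flip F).prodMk continuous_id) _
    exact (continuous_incl _).comp h2

theorem continuous_rng {Y : Type*} [TopologicalSpace Y] {f : Y → TailRel}
    (h1 : Continuous fun y => diff (f y)) (h2 : Continuous fun y => (f y).snd) :
    Continuous f := by
  have : Continuous fun y => homeo (f y) := h1.prodMk h2
  exact (homeo.symm.continuous.comp this).congr fun y => homeo.symm_apply_apply (f y)

/-- Exchange of the two sequences. -/
def swap (p : TailRel) : TailRel :=
  ⟨p.snd, p.fst, p.eventually_eq.elim fun n hn => ⟨n, fun i hi => (hn i hi).symm⟩⟩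

theorem continuous_swap : Continuous swap := by
  refine continuous_rng (continuous_diff.congr fun p => ?_) continuous_fst'
  ext i
  rw [mem_diff, mem_diff]
  exact ne_comm

theorem isLocalHomeomorph_snd : IsLocalHomeomorph TailRel.snd :=
  (isLocalHomeomorph_snd_of_discrete (Finset ℕ) (ℕ → Bool)).comp homeo.isLocalHomeomorph

theorem isLocalHomeomorph_fst : IsLocalHomeomorph TailRel.fst := by
  let e : TailRel ≃ₜ TailRel :=
    { toFun := swap
      invFun := swap
      left_inv := fun _ => rfl
      right_inv := fun _ => rfl
      continuous_toFun := continuous_swap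
      continuous_invFun := continuous_swap }
  exact isLocalHomeomorph_snd.comp e.isLocalHomeomorph

/-- Composition of pairs. -/
def trans (p q : TailRel) (e : p.snd = q.fst) : TailRel :=
  ⟨p.fst, q.snd, p.eventually_eq.elim fun n hn => q.eventually_eq.elim fun m hm => ⟨max n m, fun i hi =>
    (hn i ((le_max_left n m).trans hi)).trans
      ((congrFun e i).trans (hm i ((le_max_right n m).trans hi)))⟩⟩

theorem continuous_trans :
    Continuous fun p : {p : TailRel × TailRel // p.1.snd = p.2.fst} => trans p.1.1 p.1.2 p.2 := by
  have h : Continuous fun q : Finset ℕ × Finset ℕ => symmDiff q.1 q.2 :=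
    continuous_of_discreteTopology
  have h1 : Continuous fun p : {p : TailRel × TailRel // p.1.snd = p.2.fst} =>
      (diff p.1.1, diff p.1.2) :=
    (continuous_diff.comp (continuous_fst.comp continuous_subtype_val)).prodMk
      (continuous_diff.comp (continuous_snd.comp continuous_subtype_val))
  have h2 : Continuous fun p : {p : TailRel × TailRel // p.1.snd = p.2.fst} => p.1.2.snd :=
    continuous_snd'.comp (continuous_snd.comp continuous_subtype_val)
  refine continuous_rng ((h.comp h1).congr fun p => ?_) h2
  ext i
  have e := congrFun p.2 i
  simp only [Function.comp, Finset.mem_symmDiff, mem_diff, trans, e]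
  cases p.1.1.fst i <;> cases p.1.2.fst i <;> cases p.1.2.snd i <;> simp

end TailRel

/-- The canonical groupoid of the UHF algebra of type `2^∞`: tail equivalence on `{0,1}^ℕ` with
the inductive limit topology, `(x, y)` having range `x` and source `y`. -/
def uhfTwoInfty : EtaleGroupoid.{0, 0} where
  Obj := ℕ → Bool
  Arr := TailRel
  r p := p.fst
  s p := p.snd
  unit x := ⟨x, x, 0, fun _ _ => rfl⟩
  mul := TailRel.trans
  inv := TailRel.swap
  r_unit _ := rfl
  s_unit _ := rfl
  r_mul _ _ _ := rfl
  s_mul _ _ _ := rfl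
  r_inv _ := rfl
  s_inv _ := rfl
  unit_mul _ := rfl
  mul_unit _ := rfl
  mul_assoc _ _ _ _ _ := rfl
  mul_inv _ := rfl
  inv_mul _ := rfl
  continuous_unit := by
    have h : Continuous fun x : ℕ → Bool => (⟨(x, x), fun _ _ => rfl⟩ : TailPairs 0) :=
      Continuous.subtype_mk (continuous_id.prodMk continuous_id) _
    exact (TailRel.continuous_incl 0).comp h
  continuous_mul := TailRel.continuous_trans
  continuous_inv := TailRel.continuous_swap
  isLocalHomeomorph_r := TailRel.isLocalHomeomorph_fst
  isLocalHomeomorph_s := TailRel.isLocalHomeomorph_snd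
  t2Space_arr := by
    let : TopologicalSpace (Finset ℕ) := ⊥
    have : DiscreteTopology (Finset ℕ) := ⟨rfl⟩
    exact TailRel.homeo.symm.t2Space
  locallyCompactSpace_arr := by
    let : TopologicalSpace (Finset ℕ) := ⊥
    have : DiscreteTopology (Finset ℕ) := ⟨rfl⟩
    exact TailRel.homeo.isClosedEmbedding.locallyCompactSpace

/-! ### The infinite dihedral group as a line -/

/-! Freeness makes every orbit a copy of the line: seen from `x`, the point `g • x` sits at `coord
g`, and changing base point is a right translation, hence an isometry (`abs_coord_mul_inv`). An
arrow is thus a jump along a line.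

Upper bound: a compact set of arrows of the product makes jumps of length at most some `R`, and its
tail part lies in one compact open subgroupoid, so the second factor costs nothing. Take a clopen
marker set `M` that is `3R`-separated and `3R`-dense in every orbit (`exists_isClopen_marker`), and
cover `X` by the points within `R` of `M` and their complement. Short jumps inside the first set
stay near a single marker (`nearArrows`). Short jumps inside the second cannot cross the
`R`-neighbourhood of a marker, so they stay in one gap, whose length is bounded by density
(`farArrows`). Both families are subgroupoids of bounded length.

Lower bound: with a single open set, the arrows over `r 1` generate all its positive powers, and `r
1` has infinite order. -/

namespace DihedralGroup

/-- The position of an element of the infinite dihedral group on the Cayley graph of the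
generators `sr 0` and `sr (-1)`, which is a line. -/
def coord : DihedralGroup 0 → ℤ
  | r i => 2 * (show ℤ from i)
  | sr i => 2 * (show ℤ from i) + 1

theorem coord_one : coord 1 = 0 := rfl

theorem coord_injective : Function.Injective coord := by
  have key : ∀ a b : ℤ, 2 * a = 2 * b → a = b := fun a b h => by omega
  have key' : ∀ a b : ℤ, 2 * a + 1 ≠ 2 * b := fun a b h => by omega
  rintro (i | i) (j | j) h
  · exact congrArg r (key i j h)
  · exact absurd h.symm (key' j i)
  · exact absurd h (key' i j)
  · exact congrArg sr (key i j (add_right_cancel (b := (1 : ℤ)) h))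

theorem coord_surjective : Function.Surjective coord := fun n => by
  rcases Int.even_or_odd' n with ⟨k, rfl | rfl⟩
  · exact ⟨r (show ZMod 0 from k), rfl⟩
  · exact ⟨sr (show ZMod 0 from k), rfl⟩

/-- Right translations act on the line by translations and reflections. -/
theorem coord_mul (h : DihedralGroup 0) :
    (∀ g, coord (g * h) = coord h + coord g) ∨ ∀ g, coord (g * h) = coord h - coord g := by
  rcases h with j | j
  · left
    rintro (i | i)
    · change 2 * ((i : ℤ) + (j : ℤ)) = 2 * (j : ℤ) + 2 * (i : ℤ)
      ring
    · change 2 * ((i : ℤ) + (j : ℤ)) + 1 = 2 * (j : ℤ) + (2 * (i : ℤ) + 1)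
      ring
  · right
    rintro (i | i)
    · change 2 * ((j : ℤ) - (i : ℤ)) + 1 = 2 * (j : ℤ) + 1 - 2 * (i : ℤ)
      ring
    · change 2 * ((j : ℤ) - (i : ℤ)) = 2 * (j : ℤ) + 1 - (2 * (i : ℤ) + 1)
      ring

/-- The distance between two points of an orbit does not depend on the base point from which their
positions are read. -/
theorem abs_coord_mul_inv (g h : DihedralGroup 0) :
    |coord (g * h⁻¹)| = |coord g - coord h| := by
  have hg : coord g = coord (g * h⁻¹ * h) := by rw [inv_mul_cancel_right]
  rcases coord_mul h with H | H <;> rw [hg, H]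
  · congr 1; ring
  · rw [← abs_neg]; congr 1; ring

theorem abs_coord_inv (g : DihedralGroup 0) : |coord g⁻¹| = |coord g| := by
  simpa [coord_one] using abs_coord_mul_inv 1 g

theorem finite_abs_coord_le (n : ℤ) : {g : DihedralGroup 0 | |coord g| ≤ n}.Finite :=
  ((Set.finite_Icc (-n) n).preimage coord_injective.injOn).subset fun _ hg => abs_le.mp hg

end DihedralGroup

/-! ### Clopen markers -/

section Markers

variable {G X : Type*} [Group G] [TopologicalSpace X] [MulAction G X] [ContinuousConstSMul G X]

/-- By freeness each `g ≠ 1` moves `x`, so it moves some neighbourhood of `x` off itself; intersect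
over the finite set `S` and shrink to a clopen set. -/
theorem exists_isClopen_smul_notMem [T2Space X] [CompactSpace X] [TotallyDisconnectedSpace X]
    (hfree : ∀ (g : G) (x : X), g • x = x → g = 1) (S : Set G) (hS : S.Finite) (x : X) :
    ∃ V : Set X, IsClopen V ∧ x ∈ V ∧ ∀ g ∈ S, g ≠ 1 → ∀ y ∈ V, g • y ∉ V := by
  have key : ∀ g : G, ∃ W : Set X, IsOpen W ∧ x ∈ W ∧ (g ≠ 1 → ∀ y ∈ W, g • y ∉ W) := by
    intro g
    by_cases hg : g = 1
    · exact ⟨Set.univ, isOpen_univ, trivial, fun h => absurd hg h⟩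
    · obtain ⟨A, B, hA, hB, hxA, hxB, hAB⟩ := t2_separation fun h => hg (hfree g x h)
      refine ⟨B ∩ (g • ·) ⁻¹' A, hB.inter (hA.preimage (continuous_const_smul g)), ⟨hxB, hxA⟩, ?_⟩
      exact fun _ y hy hy' => Set.disjoint_left.mp hAB hy.2 hy'.1
  choose W hWo hxW hW using key
  obtain ⟨V, hV, hxV, hVW⟩ := compact_exists_isClopen_in_isOpen
    (hS.isOpen_biInter fun g _ => hWo g) (Set.mem_iInter₂.mpr fun g _ => hxW g)
  refine ⟨V, hV, hxV, fun g hg hg1 y hy hy' => ?_⟩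
  exact hW g hg1 y (Set.mem_iInter₂.mp (hVW hy) g hg) (Set.mem_iInter₂.mp (hVW hy') g hg)

/-- Greedy construction: each step adds the part of `V i` outside the `S`-neighbourhood of the
markers already chosen. New markers are separated from each other by `hVS`, and from old ones by the
removal and the symmetry of `S`. -/
theorem exists_isClopen_marker_of_cover (S : Set G) (hS : S.Finite)
    (hinv : ∀ g ∈ S, g⁻¹ ∈ S) (h1 : 1 ∈ S) {ι : Type*} (V : ι → Set X)
    (hV : ∀ i, IsClopen (V i)) (hVS : ∀ i, ∀ g ∈ S, g ≠ 1 → ∀ y ∈ V i, g • y ∉ V i)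
    (t : Finset ι) :
    ∃ M : Set X, IsClopen M ∧ (∀ g ∈ S, ∀ x ∈ M, g • x ∈ M → g = 1) ∧
      ∀ i ∈ t, ∀ x ∈ V i, ∃ g ∈ S, g • x ∈ M := by
  classical
  induction t using Finset.induction_on with
  | empty => exact ⟨∅, isClopen_empty, by simp, by simp⟩
  | insert i t _ ih =>
    obtain ⟨M, hM, hsep, hden⟩ := ih
    have hN : IsClopen (⋃ g ∈ S, (g • · : X → X) ⁻¹' M) :=
      hS.isClopen_biUnion fun g _ => hM.preimage (continuous_const_smul g)
    refine ⟨M ∪ V i \ ⋃ g ∈ S, (g • · : X → X) ⁻¹' M, hM.union ((hV i).diff hN), ?_, ?_⟩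
    · rintro g hg x (hx | ⟨hx, hxN⟩) (hy | ⟨hy, hyN⟩)
      · exact hsep g hg x hx hy
      · refine absurd (Set.mem_iUnion₂.mpr ⟨g⁻¹, hinv g hg, ?_⟩) hyN
        simpa using hx
      · exact absurd (Set.mem_iUnion₂.mpr ⟨g, hg, hy⟩) hxN
      · by_contra hg1
        exact hVS i g hg hg1 x hx hy
    · intro j hj x hx
      rcases Finset.mem_insert.mp hj with rfl | hj
      · by_cases hxN : x ∈ ⋃ g ∈ S, (g • · : X → X) ⁻¹' M
        · obtain ⟨g, hg, hgx⟩ := Set.mem_iUnion₂.mp hxN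
          exact ⟨g, hg, Or.inl hgx⟩
        · exact ⟨1, h1, Or.inr (by simpa only [one_smul] using ⟨hx, hxN⟩)⟩
      · obtain ⟨g, hg, hgx⟩ := hden j hj x hx
        exact ⟨g, hg, Or.inl hgx⟩

/-- A free action on a compact totally disconnected space has clopen sets that meet every orbit
in a maximal `S`-separated set. -/
theorem exists_isClopen_marker [T2Space X] [CompactSpace X] [TotallyDisconnectedSpace X]
    (hfree : ∀ (g : G) (x : X), g • x = x → g = 1) (S : Set G) (hS : S.Finite)
    (hinv : ∀ g ∈ S, g⁻¹ ∈ S) (h1 : 1 ∈ S) :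
    ∃ M : Set X, IsClopen M ∧ (∀ g ∈ S, ∀ x ∈ M, g • x ∈ M → g = 1) ∧
      ∀ x, ∃ g ∈ S, g • x ∈ M := by
  choose V hV hxV hVS using exists_isClopen_smul_notMem hfree S hS
  obtain ⟨t, ht⟩ := isCompact_univ.elim_finite_subcover V (fun x => (hV x).isOpen)
    fun x _ => Set.mem_iUnion.mpr ⟨x, hxV x⟩
  obtain ⟨M, hM, hsep, hden⟩ := exists_isClopen_marker_of_cover S hS hinv h1 V hV hVS t
  refine ⟨M, hM, hsep, fun x => ?_⟩
  obtain ⟨i, hi, hx⟩ := Set.mem_iUnion₂.mp (ht (Set.mem_univ x))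
  exact hden i hi x hx

end Markers

/-! ### Tail equivalence is an increasing union of compact open subgroupoids -/

namespace TailRel

theorem isCompact_range_incl (n : ℕ) : IsCompact (Set.range (TailPairs.incl n)) := by
  have hc : IsClosed {p : (ℕ → Bool) × (ℕ → Bool) | ∀ i, n ≤ i → p.1 i = p.2 i} := by
    simp only [Set.ofPred_forall]
    exact isClosed_iInter fun i => isClosed_iInter fun _ =>
      isClosed_eq (by fun_prop) (by fun_prop)
  have : CompactSpace (TailPairs n) := isCompact_iff_compactSpace.mp hc.isCompact
  exact isCompact_range (continuous_incl n)

theorem mem_range_incl {n : ℕ} {p : TailRel} :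
    p ∈ Set.range (TailPairs.incl n) ↔ ∀ i, n ≤ i → p.fst i = p.snd i :=
  ⟨by rintro ⟨q, rfl⟩; exact q.2, fun h => ⟨⟨(p.fst, p.snd), h⟩, rfl⟩⟩

/-- Membership depends only on the set of differing places, which is a continuous function to a
discrete space. -/
theorem isOpen_range_incl (n : ℕ) : IsOpen (Set.range (TailPairs.incl n)) := by
  let _ : TopologicalSpace (Finset ℕ) := ⊥
  have : DiscreteTopology (Finset ℕ) := ⟨rfl⟩
  have h : Set.range (TailPairs.incl n) = diff ⁻¹' {F | ∀ i ∈ F, i < n} := by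
    ext p
    simp only [mem_range_incl, Set.mem_preimage, Set.mem_ofPred_eq, mem_diff]
    exact forall_congr' fun i => by rw [← not_le, not_imp_not]
  rw [h]
  exact (isOpen_discrete _).preimage continuous_diff

theorem exists_subset_range_incl {K : Set TailRel} (hK : IsCompact K) :
    ∃ n, K ⊆ Set.range (TailPairs.incl n) := by
  refine hK.elim_directed_cover _ isOpen_range_incl (fun p _ => ?_) ?_
  · obtain ⟨n, hn⟩ := p.eventually_eq
    exact Set.mem_iUnion.mpr ⟨n, mem_range_incl.mpr hn⟩
  · refine (monotone_nat_of_le_succ fun n p hp => ?_).directed_le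
    exact mem_range_incl.mpr fun i hi => mem_range_incl.mp hp i (n.le_succ.trans hi)

theorem isSubgroupoid_range_incl (n : ℕ) :
    uhfTwoInfty.IsSubgroupoid (Set.range (TailPairs.incl n)) := by
  refine ⟨fun p hp => mem_range_incl.mpr fun i hi => (mem_range_incl.mp hp i hi).symm,
    fun p hp q hq e => mem_range_incl.mpr fun i hi => ?_⟩
  exact (mem_range_incl.mp hp i hi).trans ((congrFun e i).trans (mem_range_incl.mp hq i hi))

end TailRel

/-! ### Products with tail equivalence -/

namespace EtaleGroupoid

theorem IsSubgroupoid.prod {G : EtaleGroupoid} {H : EtaleGroupoid} {A : Set G.Arr} {B : Set H.Arr}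
    (hA : G.IsSubgroupoid A) (hB : H.IsSubgroupoid B) :
    (G.prod H).IsSubgroupoid (A ×ˢ B) :=
  ⟨fun g hg => ⟨hA.1 g.1 hg.1, hB.1 g.2 hg.2⟩, fun g hg h hh e =>
    ⟨hA.2 g.1 hg.1 h.1 hh.1 (congrArg Prod.fst e), hB.2 g.2 hg.2 h.2 hh.2 (congrArg Prod.snd e)⟩⟩

/-- Taking the product with tail equivalence does not increase the dynamic asymptotic dimension
of a groupoid in which the covering property holds for all compact sets. -/
theorem hasDadProperty_prod_uhfTwoInfty {G : EtaleGroupoid} {d : ℕ}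
    (hG : ∀ C : Set G.Arr, IsCompact C → ∃ U : Fin (d + 1) → Set G.Obj,
      (∀ i, IsOpen (U i)) ∧ ⋃ i, U i = Set.univ ∧
      ∀ i, ∃ H : Set G.Arr, G.IsSubgroupoid H ∧ IsCompact (closure H) ∧
        {g | g ∈ C ∧ G.s g ∈ U i ∧ G.r g ∈ U i} ⊆ H) :
    (G.prod uhfTwoInfty).HasDadProperty d := by
  intro K _ hK
  obtain ⟨n, hn⟩ := TailRel.exists_subset_range_incl (hK.image continuous_snd)
  obtain ⟨U, hUo, hU, hH⟩ := hG _ (hK.image continuous_fst)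
  refine ⟨fun i => U i ×ˢ Set.univ, fun i => (hUo i).prod isOpen_univ, fun x _ => ?_, fun i => ?_⟩
  · obtain ⟨i, hi⟩ := Set.mem_iUnion.mp (hU.ge (Set.mem_univ x.1))
    exact Set.mem_iUnion.mpr ⟨i, hi, trivial⟩
  · obtain ⟨H, hH, hHc, hKH⟩ := hH i
    refine ⟨H ×ˢ Set.range (TailPairs.incl n), hH.prod (TailRel.isSubgroupoid_range_incl n), ?_, ?_⟩
    · have : T2Space (G.Arr × TailRel) := (G.prod uhfTwoInfty).t2Space_arr
      exact (hHc.prod (TailRel.isCompact_range_incl n)).closure_of_subset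
        (Set.prod_mono subset_closure subset_rfl)
    · rintro g ⟨hg, hs, hr⟩
      exact ⟨hKH ⟨⟨g, subset_closure hg, rfl⟩, hs.1, hr.1⟩, hn ⟨g, subset_closure hg, rfl⟩⟩

end EtaleGroupoid

/-! ### Free actions of the infinite dihedral group -/

section Dihedral

open DihedralGroup

theorem isCompact_closure_of_abs_coord_le {X : Type*} [TopologicalSpace X]
    [CompactSpace X] [T2Space X] {H : Set (DihedralGroup 0 × X)} (n : ℤ)
    (h : ∀ p ∈ H, |coord p.1| ≤ n) : IsCompact (closure H) :=
  ((finite_abs_coord_le n).isCompact.prod isCompact_univ).closure_of_subset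
    fun p hp => ⟨h p hp, trivial⟩

variable {X : Type*} [MulAction (DihedralGroup 0) X]

/-- The arrows between points that are close to the same point of `M`. -/
def nearArrows (M : Set X) (R : ℤ) : Set (DihedralGroup 0 × X) :=
  {p | ∃ m : DihedralGroup 0, m • p.2 ∈ M ∧ |coord m| ≤ R ∧ |coord m - coord p.1| ≤ R}

/-- The arrows such that no point of `M` is close to the segment between source and range. -/
def farArrows (M : Set X) (R : ℤ) : Set (DihedralGroup 0 × X) :=
  {p | ∀ m : DihedralGroup 0, m • p.2 ∈ M →
    (R < coord m ∧ R < coord m - coord p.1) ∨ (coord m < -R ∧ coord m - coord p.1 < -R)}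

/-- The element `m * m'⁻¹` carries one marker to the other, and its length is their distance. -/
theorem eq_of_separated {M : Set X} {N : ℤ}
    (hsep : ∀ g : DihedralGroup 0, |coord g| ≤ N → ∀ x ∈ M, g • x ∈ M → g = 1)
    {x : X} {m m' : DihedralGroup 0} (hm : m • x ∈ M) (hm' : m' • x ∈ M)
    (h : |coord m - coord m'| ≤ N) : m = m' := by
  refine mul_inv_eq_one.mp (hsep (m * m'⁻¹) ?_ _ hm' ?_)
  · rwa [abs_coord_mul_inv]
  · rwa [smul_smul, inv_mul_cancel_right]

theorem abs_coord_le_of_mem_nearArrows {M : Set X} {R : ℤ} {p : DihedralGroup 0 × X}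
    (hp : p ∈ nearArrows M R) : |coord p.1| ≤ 2 * R := by
  obtain ⟨m, -, h1, h2⟩ := hp
  rw [abs_le] at *
  omega

theorem abs_coord_le_of_mem_farArrows {M : Set X} {N R : ℤ} (hR : 0 ≤ R)
    (hden : ∀ x : X, ∃ g : DihedralGroup 0, |coord g| ≤ N ∧ g • x ∈ M)
    {p : DihedralGroup 0 × X} (hp : p ∈ farArrows M R) : |coord p.1| ≤ 2 * N := by
  by_contra! hlt
  -- Density based at the point in position `n`: every window of radius `N` contains a marker.
  have key : ∀ n : ℤ, ∃ m : DihedralGroup 0, |coord m - n| ≤ N ∧ m • p.2 ∈ M := fun n => by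
    obtain ⟨k, rfl⟩ := coord_surjective n
    obtain ⟨g, hg, hgM⟩ := hden (k • p.2)
    refine ⟨g * k, ?_, by rwa [mul_smul]⟩
    rwa [← abs_coord_mul_inv, mul_inv_cancel_right]
  rcases lt_abs.mp hlt with h | h
  · obtain ⟨m, hm, hmM⟩ := key N
    have := hp m hmM
    rw [abs_le] at hm
    omega
  · obtain ⟨m, hm, hmM⟩ := key (-N)
    have := hp m hmM
    rw [abs_le] at hm
    omega

variable [TopologicalSpace X] [CompactSpace X] [T2Space X]
  [ContinuousConstSMul (DihedralGroup 0) X]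

/-- Composable arrows share their middle point, which by separation is near only one marker. -/
theorem isSubgroupoid_nearArrows {M : Set X} {N R : ℤ} (hN : 2 * R ≤ N)
    (hsep : ∀ g : DihedralGroup 0, |coord g| ≤ N → ∀ x ∈ M, g • x ∈ M → g = 1) :
    (transformationGroupoid (DihedralGroup 0) X).IsSubgroupoid (nearArrows M R) := by
  constructor
  · rintro ⟨g, x⟩ ⟨m, hm, h1, h2⟩
    refine ⟨m * g⁻¹, ?_, ?_, ?_⟩
    · change (m * g⁻¹) • g • x ∈ M
      rwa [smul_smul, inv_mul_cancel_right]
    · rwa [abs_coord_mul_inv]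
    · change |coord (m * g⁻¹) - coord g⁻¹| ≤ R
      rwa [← abs_coord_mul_inv, inv_inv, inv_mul_cancel_right]
  · rintro ⟨g, y⟩ ⟨m', hm', h1', h2'⟩ ⟨h, x⟩ ⟨m, hm, h1, h2⟩ (rfl : y = h • x)
    change m' • h • x ∈ M at hm'
    rw [smul_smul] at hm'
    dsimp only at hm h1 h2 h1' h2'
    -- Both markers are within `R` of the middle point `coord h`, hence within `2 * R ≤ N` of each
    -- other.
    have e : m' * h = m := by
      refine eq_of_separated hsep hm' hm ?_
      rcases coord_mul h with H | H <;> rw [H] <;> rw [abs_le] at * <;> omega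
    refine ⟨m, hm, h1, ?_⟩
    change |coord m - coord (g * h)| ≤ R
    rw [← e]
    rcases coord_mul h with H | H <;> rw [H, H] <;> rw [abs_le] at * <;> omega

/-- Relative to each marker, both ends of an arrow lie on the same side; composites inherit this
through the middle point. A reflection of the line merely exchanges the two alternatives. -/
theorem isSubgroupoid_farArrows (M : Set X) {R : ℤ} (hR : 0 ≤ R) :
    (transformationGroupoid (DihedralGroup 0) X).IsSubgroupoid (farArrows M R) := by
  constructor
  · rintro ⟨g, x⟩ hp m (hm : m • g • x ∈ M)
    rw [smul_smul] at hm
    have := hp _ hm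
    have hg : coord (g⁻¹ * g) = 0 := by rw [inv_mul_cancel, coord_one]
    change (R < coord m ∧ R < coord m - coord g⁻¹) ∨ (coord m < -R ∧ coord m - coord g⁻¹ < -R)
    dsimp only at this
    rcases coord_mul g with H | H <;> rw [H] at this hg <;> omega
  · rintro ⟨g, y⟩ hp' ⟨h, x⟩ hp (rfl : y = h • x) m (hm : m • x ∈ M)
    have h1 := hp _ hm
    have h2 := hp' (m * h⁻¹) (by
      change (m * h⁻¹) • h • x ∈ M
      rwa [smul_smul, inv_mul_cancel_right])
    have hm' : coord m = coord (m * h⁻¹ * h) := by rw [inv_mul_cancel_right]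
    change (R < coord m ∧ R < coord m - coord (g * h)) ∨
      (coord m < -R ∧ coord m - coord (g * h) < -R)
    dsimp only at h1 h2
    rcases coord_mul h with H | H <;> rw [H] at hm' ⊢ <;> omega

theorem exists_cover_transformationGroupoid_dihedral [TotallyDisconnectedSpace X]
    (hfree : ∀ (g : DihedralGroup 0) (x : X), g • x = x → g = 1)
    (C : Set (transformationGroupoid (DihedralGroup 0) X).Arr) (hC : IsCompact C) :
    ∃ U : Fin 2 → Set (transformationGroupoid (DihedralGroup 0) X).Obj,
      (∀ i, IsOpen (U i)) ∧ ⋃ i, U i = Set.univ ∧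
      ∀ i, ∃ H : Set (transformationGroupoid (DihedralGroup 0) X).Arr,
        (transformationGroupoid (DihedralGroup 0) X).IsSubgroupoid H ∧ IsCompact (closure H) ∧
        {g | g ∈ C ∧ (transformationGroupoid (DihedralGroup 0) X).s g ∈ U i ∧
          (transformationGroupoid (DihedralGroup 0) X).r g ∈ U i} ⊆ H := by
  change Set (DihedralGroup 0 × X) at C
  obtain ⟨R, hR⟩ : ∃ R : ℤ, ∀ p ∈ C, |coord p.1| ≤ R := by
    have hfin : (Prod.fst '' C).Finite := (hC.image continuous_fst).finite_of_discrete
    obtain ⟨R, hR⟩ := (hfin.image fun g => |coord g|).bddAbove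
    exact ⟨R, fun p hp => hR ⟨p.1, ⟨p, hp, rfl⟩, rfl⟩⟩
  -- For empty `C` the previous bound could be negative.
  obtain ⟨R, hR0, hR⟩ : ∃ R : ℤ, 0 ≤ R ∧ ∀ p ∈ C, |coord p.1| ≤ R :=
    ⟨max R 0, le_max_right _ _, fun p hp => (hR p hp).trans (le_max_left _ _)⟩
  -- The `3 * R` is marker to source, source to range, range to marker, each at most `R`.
  obtain ⟨M, hM, hsep, hden⟩ := exists_isClopen_marker hfree _ (finite_abs_coord_le (3 * R))
    (fun g hg => (abs_coord_inv g).trans_le hg)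
    (show |coord 1| ≤ 3 * R by rw [coord_one, abs_zero]; omega)
  have hU : IsClopen (⋃ m ∈ {g : DihedralGroup 0 | |coord g| ≤ R}, (m • · : X → X) ⁻¹' M) :=
    (finite_abs_coord_le R).isClopen_biUnion fun g _ => hM.preimage (continuous_const_smul g)
  set U : Set X := ⋃ m ∈ {g : DihedralGroup 0 | |coord g| ≤ R}, (m • · : X → X) ⁻¹' M with hUdef
  have memU : ∀ x, x ∈ U ↔ ∃ m : DihedralGroup 0, |coord m| ≤ R ∧ m • x ∈ M := fun x => by
    simp [hUdef]
  refine ⟨![U, Uᶜ], ?_, ?_, ?_⟩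
  · rw [Fin.forall_fin_two]
    exact ⟨hU.isOpen, hU.compl.isOpen⟩
  · refine Set.eq_univ_of_forall fun x => ?_
    by_cases hx : x ∈ U
    · exact Set.mem_iUnion.mpr ⟨0, hx⟩
    · exact Set.mem_iUnion.mpr ⟨1, hx⟩
  · rw [Fin.forall_fin_two]
    refine ⟨⟨nearArrows M R, isSubgroupoid_nearArrows (by omega) hsep,
      isCompact_closure_of_abs_coord_le _ fun _ => abs_coord_le_of_mem_nearArrows, ?_⟩,
      ⟨farArrows M R, isSubgroupoid_farArrows M hR0,
      isCompact_closure_of_abs_coord_le _ fun _ => abs_coord_le_of_mem_farArrows hR0 hden, ?_⟩⟩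
    · rintro ⟨g, x⟩ ⟨hg, hs, hr⟩
      obtain ⟨m, hm, hmM⟩ := (memU x).mp hs
      obtain ⟨k, hk, hkM⟩ := (memU (g • x)).mp hr
      rw [smul_smul] at hkM
      have hgR := hR _ hg
      have hk' : |coord (k * g) - coord g| ≤ R := by
        rwa [← abs_coord_mul_inv, mul_inv_cancel_right]
      dsimp only at hgR
      have e : k * g = m := by
        refine eq_of_separated hsep hkM hmM ?_
        rw [abs_le] at *
        omega
      exact ⟨m, hmM, hm, e ▸ hk'⟩
    -- Both ends are more than `R` from the marker; opposite sides would need a jump longer than `2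
    -- * R`.
    · rintro ⟨g, x⟩ ⟨hg, hs, hr⟩ m hm
      have h1 : ¬ |coord m| ≤ R := fun h => hs ((memU x).mpr ⟨m, h, hm⟩)
      have h2 : ¬ |coord m - coord g| ≤ R := fun h => hr ((memU (g • x)).mpr ⟨m * g⁻¹, by
        rwa [abs_coord_mul_inv], by rwa [smul_smul, inv_mul_cancel_right]⟩)
      have hgR := hR _ hg
      dsimp only at hgR hm ⊢
      rw [abs_le] at *
      omega

/-! ### The lower bound -/

theorem not_hasDadProperty_zero_dihedral_prod [Nonempty X] :
    ¬ ((transformationGroupoid (DihedralGroup 0) X).prod uhfTwoInfty).HasDadProperty 0 := by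
  intro h
  -- `TailPairs.incl 0` has the diagonal as range, so the second factor contributes only units.
  have hKo : IsOpen (({r 1} ×ˢ Set.univ) ×ˢ Set.range (TailPairs.incl 0) :
      Set ((DihedralGroup 0 × X) × TailRel)) :=
    ((isOpen_discrete _).prod isOpen_univ).prod (TailRel.isOpen_range_incl 0)
  have hKc : IsCompact (({r 1} ×ˢ Set.univ) ×ˢ Set.range (TailPairs.incl 0) :
      Set ((DihedralGroup 0 × X) × TailRel)) :=
    (isCompact_singleton.prod isCompact_univ).prod (TailRel.isCompact_range_incl 0)
  have : T2Space ((DihedralGroup 0 × X) × TailRel) :=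
    ((transformationGroupoid (DihedralGroup 0) X).prod uhfTwoInfty).t2Space_arr
  obtain ⟨U, -, hU, hH⟩ := h _ hKo (hKc.closure_of_subset subset_rfl)
  obtain ⟨H, hH, hHc, hKH⟩ := hH 0
  let y : ℕ → Bool := fun _ => false
  let u : TailRel := uhfTwoInfty.unit y
  have hu : u ∈ Set.range (TailPairs.incl 0) := TailRel.mem_range_incl.mpr fun _ _ => rfl
  have hUx : ∀ x : X, (x, y) ∈ U 0 := fun x => by
    obtain ⟨i, hi⟩ := Set.mem_iUnion.mp (hU (Or.inl ⟨((r 1, x), u), ⟨⟨rfl, trivial⟩, hu⟩, rfl⟩))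
    rwa [Fin.fin_one_eq_zero i] at hi
  have hone : ∀ x : X, ((r 1, x), u) ∈ H := fun x =>
    hKH ⟨⟨⟨rfl, trivial⟩, hu⟩, hUx x, hUx _⟩
  have hpow : ∀ (n : ℕ) (x : X), (((r 1 : DihedralGroup 0) ^ (n + 1), x), u) ∈ H := by
    intro n x
    induction n with
    | zero => simpa using hone x
    | succ n ih =>
      rw [pow_succ' _ (n + 1)]
      exact hH.2 _ (hone ((r 1 : DihedralGroup 0) ^ (n + 1) • x)) _ ih rfl
  obtain ⟨x⟩ := ‹Nonempty X›
  -- A compact set of arrows involves only finitely many elements of the discrete group.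
  have hfin : ((fun p : (DihedralGroup 0 × X) × TailRel => p.1.1) '' closure H).Finite :=
    (hHc.image (continuous_fst.comp continuous_fst)).finite_of_discrete
  refine Set.infinite_of_injective_forall_mem (f := fun n : ℕ => (r 1 : DihedralGroup 0) ^ (n + 1))
    (fun a b hab => ?_) (fun n => Set.mem_image_of_mem
      (fun p : (DihedralGroup 0 × X) × TailRel => p.1.1) (subset_closure (hpow n x))) hfin
  have := congrArg coord hab
  simp only [r_one_pow, coord] at this
  change 2 * (((a + 1 : ℕ) : ℤ)) = 2 * (((b + 1 : ℕ) : ℤ)) at this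
  omega

end Dihedral

theorem proposition3p6 (X : Type*) [TopologicalSpace X] [IsCantorSpace X]
    [MulAction (DihedralGroup 0) X] [ContinuousConstSMul (DihedralGroup 0) X]
    [MulAction.IsMinimal (DihedralGroup 0) X]
    (hfree : ∀ (g : DihedralGroup 0) (x : X), g • x = x → g = 1) :
    ((transformationGroupoid (DihedralGroup 0) X).prod uhfTwoInfty).dad = 1 := by
  obtain ⟨e⟩ := IsCantorSpace.nonempty_homeomorph (X := X)
  have : TotallyDisconnectedSpace X := e.symm.totallyDisconnectedSpace
  have : Nonempty X := ⟨e.symm fun _ => false⟩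
  refine le_antisymm (iInf₂_le_of_le 1 (EtaleGroupoid.hasDadProperty_prod_uhfTwoInfty
    (exists_cover_transformationGroupoid_dihedral hfree)) le_rfl) (le_iInf₂ fun d hd => ?_)
  rw [Nat.one_le_cast, Nat.one_le_iff_ne_zero]
  rintro rfl
  exact not_hasDadProperty_zero_dihedral_prod hd
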